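/- **Theorem 2.** For $\sigma\in\mathfrak S_n$, the symmetric group on $\{1,\dots,n\}$, let $\hat d(\sigma)$ be the number of $i\in\{1,\dots,n-1\}$ such that either $i$ is odd and $\sigma(i)>\sigma(i+1)$, or $i$ is even and $\sigma(i)<\sigma(i+1)$, and put $\hat A_n(x)=\sum_{\sigma\in\mathfrak S_n}x^{\hat d(\sigma)}$. Let $\mathcal B_n$ be the set of permutations $\sigma$ of $\{\pm1,\dots,\pm n\}$ with $\sigma(-i)=-\sigma(i)$ for all $i$. For $\sigma\in\mathcal B_n$ put $\sigma(0)=0$, let $\hat d_B(\sigma)$ be the number of $i\in\{0,1,\dots,n-1\}$ such that either $i$ is even and $\sigma(i)<\sigma(i+1)$, or $i$ is odd and $\sigma(i)>\sigma(i+1)$, and put $\hat B_n(x)=\sum_{\sigma\in\mathcal B_n}x^{\hat d_B(\sigma)}$. Let $P_n$ and $Q_n$ be the derivative polynomials of tangent and secant, that is, the unique real polynomials with $$\frac{d^n}{d\theta^n}\tan\theta=P_n(\tan\theta),\qquad \frac{d^n}{d\theta^n}\sec\theta=Q_n(\tan\theta)\sec\theta$$ for all real $\theta$ with $\cos\theta\neq0$.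 Then, as identities in the field $\mathbb R(x)$ of rational functions, $$2^n(1+x^2)\hat A_n(x)=(1-x)^{n+1}P_n\!\left(\frac{1+x}{1-x}\right)\quad\text{for all } n\ge1,$$ $$\hat B_n(x)=(1-x)^{n}Q_n\!\left(\frac{1+x}{1-x}\right)\quad\text{for all } n\ge0.$$ -/

import Mathlib

open Polynomial

namespace AltDescent

/-- The letter `σ(i)` (for `1 ≤ i ≤ n`) of the one-line notation `σ(1)⋯σ(n)`, with letters
`1, …, n`; here `Fin n = {0, …, n - 1}` is shifted by one. The value outside `1 ≤ i ≤ n`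
is never used. -/
def letter {n : ℕ} (σ : Equiv.Perm (Fin n)) (i : ℕ) : ℕ :=
  if h : 1 ≤ i ∧ i ≤ n then (σ ⟨i - 1, by omega⟩ : ℕ) + 1 else 0

/-- The set of alternating descent positions `i`, `1 ≤ i ≤ n - 1`, of a permutation. -/
def altDescents {n : ℕ} (σ : Equiv.Perm (Fin n)) : Finset ℕ :=
  {i ∈ Finset.Ico 1 n |
    (Odd i ∧ letter σ i > letter σ (i + 1)) ∨ (Even i ∧ letter σ i < letter σ (i + 1))}

/-- The alternating Eulerian polynomial of type A. -/
noncomputable def altEulerianA (n : ℕ) : ℝ[X] :=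
  ∑ σ : Equiv.Perm (Fin n), X ^ (altDescents σ).card

/-- The set `[±n] = {1, …, n} ∪ {-1, …, -n}`. -/
noncomputable def plusMinus (n : ℕ) : Finset ℤ := (Finset.Icc (-(n : ℤ)) n).erase 0

/-- Permutations of type B: permutations `σ` of `[±n]` such that `σ(-i) = -σ(i)`. -/
abbrev SignedPerm (n : ℕ) : Type :=
  {σ : Equiv.Perm (plusMinus n) // ∀ i j : plusMinus n, (j : ℤ) = -i → (σ j : ℤ) = -(σ i : ℤ)}

/-- The letter `σ(i)` (for `0 ≤ i ≤ n`) of the word `σ(0)σ(1)⋯σ(n)`, where `σ(0) = 0`. The value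
for `i > n` is never used. -/
noncomputable def signedLetter {n : ℕ} (σ : SignedPerm n) (i : ℕ) : ℤ :=
  if h : (i : ℤ) ∈ plusMinus n then (σ.1 ⟨i, h⟩ : ℤ) else 0

/-- The set of alternating descent positions `i`, `0 ≤ i ≤ n - 1`, of a type B permutation. -/
noncomputable def altDescentsB {n : ℕ} (σ : SignedPerm n) : Finset ℕ :=
  {i ∈ Finset.range n |
    (Even i ∧ signedLetter σ i < signedLetter σ (i + 1)) ∨
      (Odd i ∧ signedLetter σ i > signedLetter σ (i + 1))}

/-- The alternating Eulerian polynomial of type B. -/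
noncomputable def altEulerianB (n : ℕ) : ℝ[X] :=
  ∑ σ : SignedPerm n, X ^ (altDescentsB σ).card

/-- `P` satisfies `dⁿ/dxⁿ tan x = P(tan x)` wherever the tangent is defined. -/
def IsTanDerivPoly (n : ℕ) (P : ℝ[X]) : Prop :=
  ∀ x : ℝ, Real.cos x ≠ 0 → iteratedDeriv n Real.tan x = P.eval (Real.tan x)

/-- `Q` satisfies `dⁿ/dxⁿ sec x = Q(tan x) sec x` wherever the secant is defined. -/
def IsSecDerivPoly (n : ℕ) (Q : ℝ[X]) : Prop :=
  ∀ x : ℝ, Real.cos x ≠ 0 →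
    iteratedDeriv n (fun y => (Real.cos y)⁻¹) x = Q.eval (Real.tan x) * (Real.cos x)⁻¹

theorem eventually_cos_ne {x : ℝ} (hx : Real.cos x ≠ 0) :
    ∀ᶠ y in nhds x, Real.cos y ≠ 0 :=
  Real.continuous_cos.continuousAt.eventually_ne hx

theorem hasDerivAt_tan_sq {x : ℝ} (hx : Real.cos x ≠ 0) :
    HasDerivAt Real.tan (1 + Real.tan x ^ 2) x := by
  have h := Real.hasDerivAt_tan hx
  have e : 1 / Real.cos x ^ 2 = 1 + Real.tan x ^ 2 := by
    rw [Real.tan_eq_sin_div_cos]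
    field_simp
    linarith [Real.sin_sq_add_cos_sq x]
  rwa [e] at h

theorem hasDerivAt_sec {x : ℝ} (hx : Real.cos x ≠ 0) :
    HasDerivAt (fun y => (Real.cos y)⁻¹) (Real.tan x * (Real.cos x)⁻¹) x := by
  have h := (Real.hasDerivAt_cos x).inv hx
  have e : -(-Real.sin x) / Real.cos x ^ 2 = Real.tan x * (Real.cos x)⁻¹ := by
    rw [Real.tan_eq_sin_div_cos]
    field_simp
    try ring
  rw [e] at h
  exact h

theorem IsTanDerivPoly.succ {n : ℕ} {P : ℝ[X]} (h : IsTanDerivPoly n P) :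
    IsTanDerivPoly (n + 1) ((1 + X ^ 2) * derivative P) := by
  intro x hx
  have h1 : iteratedDeriv n Real.tan =ᶠ[nhds x] fun y => P.eval (Real.tan y) := by
    filter_upwards [eventually_cos_ne hx] with y hy using h y hy
  have h2 : HasDerivAt (fun y => P.eval (Real.tan y)) _ x :=
    (P.hasDerivAt (Real.tan x)).comp x (hasDerivAt_tan_sq hx)
  rw [iteratedDeriv_succ, h1.deriv_eq, h2.deriv]
  simp
  ring

theorem IsSecDerivPoly.succ {n : ℕ} {Q : ℝ[X]} (h : IsSecDerivPoly n Q) :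
    IsSecDerivPoly (n + 1) (X * Q + (1 + X ^ 2) * derivative Q) := by
  intro x hx
  have h1 : iteratedDeriv n (fun y => (Real.cos y)⁻¹) =ᶠ[nhds x]
      fun y => Q.eval (Real.tan y) * (Real.cos y)⁻¹ := by
    filter_upwards [eventually_cos_ne hx] with y hy using h y hy
  have h2 : HasDerivAt (fun y => Q.eval (Real.tan y)) _ x :=
    (Q.hasDerivAt (Real.tan x)).comp x (hasDerivAt_tan_sq hx)
  have h3 : HasDerivAt (fun y => Q.eval (Real.tan y) * (Real.cos y)⁻¹) _ x :=
    h2.mul (hasDerivAt_sec hx)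
  rw [iteratedDeriv_succ, h1.deriv_eq, h3.deriv]
  simp
  ring

theorem existsUnique_tanDerivPoly (n : ℕ) : ∃! P : ℝ[X], IsTanDerivPoly n P := by
  refine existsUnique_of_exists_of_unique ?_ ?_
  · induction n with
    | zero => exact ⟨X, fun x _ => by simp⟩
    | succ n ih => exact ih.elim fun P hP => ⟨_, hP.succ⟩
  · intro P₁ P₂ h₁ h₂
    refine Polynomial.funext fun r => ?_
    have := (h₁ _ (Real.cos_arctan_pos r).ne').symm.trans (h₂ _ (Real.cos_arctan_pos r).ne')
    rwa [Real.tan_arctan] at this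

theorem existsUnique_secDerivPoly (n : ℕ) : ∃! Q : ℝ[X], IsSecDerivPoly n Q := by
  refine existsUnique_of_exists_of_unique ?_ ?_
  · induction n with
    | zero => exact ⟨1, fun x _ => by simp⟩
    | succ n ih => exact ih.elim fun Q hQ => ⟨_, hQ.succ⟩
  · intro Q₁ Q₂ h₁ h₂
    refine Polynomial.funext fun r => ?_
    have hc := (Real.cos_arctan_pos r).ne'
    have := (h₁ _ hc).symm.trans (h₂ _ hc)
    rw [Real.tan_arctan] at this
    exact mul_right_cancel₀ (inv_ne_zero hc) this

/-- The derivative polynomial `P_n` of the tangent: the unique real polynomial with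
`dⁿ/dxⁿ tan x = P_n(tan x)`. -/
noncomputable def tanDerivPoly (n : ℕ) : ℝ[X] := (existsUnique_tanDerivPoly n).choose

/-- The derivative polynomial `Q_n` of the secant: the unique real polynomial with
`dⁿ/dxⁿ sec x = Q_n(tan x) sec x`. -/
noncomputable def secDerivPoly (n : ℕ) : ℝ[X] := (existsUnique_secDerivPoly n).choose

end AltDescent

/-! Negating a word exchanges ascents and descents, exactly as shifting its positions by one does.
Hence, when a letter `±m` of largest absolute value is inserted and everything after it is negated,
the alternating descents inside both remaining pieces survive. Only the gap used changes: inside the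
word its factor `1` or `X` becomes `1 + X ^ 2` (summed over both signs), and an insertion at a free
end gives `1 + X`. Summing over the gaps yields first-order differential recurrences
(`wordPolyB_succ`, `wordPolyA_succ`).

In type B the words are signed permutations preceded by `0`. In type A the sum also runs over signed
words: for each of the `2 ^ n` choices of negative values, relabelling in increasing order gives a
copy of the symmetric group, whence the factor `2 ^ n` (`wordPolyA_eq`).

With `t = (1 + x) / (1 - x)` one has `dt/dx = 2 / (1 - x) ^ 2` and `1 + t ^ 2 = 2 * (1 + x ^ 2) / (1
- x) ^ 2`. This turns the recurrences `P ↦ (1 + t ^ 2) P'` and `Q ↦ t Q + (1 + t ^ 2) Q'` into the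
combinatorial ones. The identities at real `x ≠ 1` then lift to `RatFunc ℝ`. -/

namespace AltDescent

/-! ### Alternating descents of words and insertion of an extreme letter -/

section Words

variable {α β : Type*} [LinearOrder α] [LinearOrder β]

/-- The number of alternating descents of a word; the flag tells whether the first pair of
letters is counted when it is a descent (`true`) or when it is an ascent (`false`). -/
def altDesc : Bool → List α → ℕ
  | b, x :: y :: l => (if (if b then x > y else x < y) then 1 else 0) + altDesc (!b) (y :: l)
  | _, _ => 0

theorem altDesc_cons_cons (b : Bool) (x y : α) (l : List α) :
    altDesc b (x :: y :: l) =
      (if (if b then x > y else x < y) then 1 else 0) + altDesc (!b) (y :: l) := rfl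

theorem altDesc_map_strictMono {e : α → β} (he : StrictMono e) (b : Bool) (l : List α) :
    altDesc b (l.map e) = altDesc b l := by
  induction l generalizing b with
  | nil => rfl
  | cons x l ih =>
    cases l with
    | nil => rfl
    | cons y l =>
      have := ih (!b)
      simp only [List.map_cons, altDesc_cons_cons, gt_iff_lt, he.lt_iff_lt] at this ⊢
      rw [this]

/-- Negation reverses every comparison. This offsets the parity shift that an inserted letter causes
in the letters after it. -/
theorem altDesc_map_neg (b : Bool) (l : List ℤ) :
    altDesc b (l.map Neg.neg) = altDesc (!b) l := by
  induction l generalizing b with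
  | nil => rfl
  | cons x l ih =>
    cases l with
    | nil => rfl
    | cons y l =>
      have := ih (!b)
      simp only [List.map_cons, altDesc_cons_cons] at this ⊢
      rw [this]
      cases b <;> simp

theorem altDesc_map_range (b : Bool) (g : ℕ → α) (n : ℕ) :
    altDesc b ((List.range (n + 1)).map g) =
      ∑ i ∈ Finset.range n,
        if (if (b ^^ decide (Odd i)) then g i > g (i + 1) else g i < g (i + 1)) then 1 else 0 := by
  induction n generalizing b g with
  | zero => rfl
  | succ n ih =>
    have h := ih (!b) (fun i => g (i + 1))
    rw [List.range_succ_eq_map, List.map_cons, List.map_map]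
    have e : (List.range (n + 1)).map (g ∘ Nat.succ) =
        g 1 :: (List.range n).map (fun i => g (i + 1 + 1)) := by
      rw [List.range_succ_eq_map, List.map_cons, List.map_map]; rfl
    have e' : (List.range (n + 1)).map (fun i => g (i + 1)) =
        g 1 :: (List.range n).map (fun i => g (i + 1 + 1)) := e
    rw [e, altDesc_cons_cons, ← e', h, Finset.sum_range_succ', add_comm]
    congr 1
    · refine Finset.sum_congr rfl fun i _ => ?_
      by_cases hi : Odd i <;> cases b <;> simp [hi, Nat.odd_add_one]
    · simp

/-- Insert `a` at position `j` of the word `w`, negating all the letters after it. -/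
def insertNeg (a : ℤ) (w : List ℤ) (j : ℕ) : List ℤ :=
  w.take j ++ a :: (w.drop j).map Neg.neg

theorem insertNeg_zero (a : ℤ) (w : List ℤ) : insertNeg a w 0 = a :: w.map Neg.neg := rfl

theorem insertNeg_cons_succ (a x : ℤ) (w : List ℤ) (j : ℕ) :
    insertNeg a (x :: w) (j + 1) = x :: insertNeg a w j := rfl

/-- Let `k` of the `w.length` gaps be counted. Appending `±m` gives `(1 + X) * X ^ k`; a counted gap
gives `(1 + X ^ 2) * X ^ (k - 1)` and any other `(1 + X ^ 2) * X ^ k`. The excess of the counted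
gaps, `k * X ^ (k - 1) * (1 - X) * (1 + X ^ 2)`, is the derivative term. -/
theorem sum_insertNeg_cons {m : ℤ} (b : Bool) (x : ℤ) (w : List ℤ) (hx : |x| < m)
    (hw : ∀ y ∈ w, |y| < m) :
    ∑ j ∈ Finset.range (w.length + 1),
      ((X : ℝ[X]) ^ altDesc b (x :: insertNeg m w j) + X ^ altDesc b (x :: insertNeg (-m) w j)) =
    (1 + X + (w.length : ℝ[X]) * (1 + X ^ 2)) * X ^ altDesc b (x :: w) +
      (1 - X) * (1 + X ^ 2) * derivative (X ^ altDesc b (x :: w)) := by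
  obtain ⟨h1, h2⟩ := abs_lt.1 hx
  induction w generalizing b x with
  | nil =>
    have h3 : ¬ m < x := by omega
    have h4 : ¬ x < -m := by omega
    cases b <;> simp [insertNeg, altDesc, h2, h1, h3, h4, add_comm]
  | cons y w ih =>
    have hy : |y| < m := hw y (by simp)
    obtain ⟨h5, h6⟩ := abs_lt.1 hy
    have h3 : ¬ m < x := by omega
    have h4 : ¬ x < -m := by omega
    have h7 : -y < m := by omega
    have h8 : ¬ m < -y := by omega
    have h9 : ¬ m < y := by omega
    have ih' := ih (!b) y hy (fun z hz => hw z (by simp [hz])) h5 h6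
    rw [List.length_cons, Finset.sum_range_succ']
    simp only [insertNeg_cons_succ, insertNeg_zero, altDesc_cons_cons, pow_add, ← mul_add,
      ← Finset.mul_sum, List.map_cons]
    rw [ih', ← List.map_cons, altDesc_map_neg]
    simp only [Bool.not_not]
    generalize altDesc (!b) (y :: w) = k
    -- Of the triples `x, m, -y` and `x, -m, -y`, one has both pairs counted and the other neither,
    -- whatever `x` and `y` are.
    have key : (X : ℝ[X]) ^ (if (if b then x > m else x < m) then 1 else 0) *
          (X ^ (if (if (!b) then m > -y else m < -y) then 1 else 0) * X ^ k) +
        X ^ (if (if b then x > -m else x < -m) then 1 else 0) *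
          (X ^ (if (if (!b) then -m > -y else -m < -y) then 1 else 0) * X ^ k) =
        (1 + X ^ 2) * X ^ k := by
      cases b <;> simp [h1, h2, h3, h4, h6, h7, h8, h9] <;> ring
    rw [key]
    push_cast
    split_ifs
    all_goals simp only [derivative_mul, derivative_X, pow_one, pow_zero, derivative_one]
    all_goals ring

/-- Without a fixed first letter both ends are free, so `1 + X` occurs twice and `w.length - 1`
inner gaps remain. The empty word has a single end and breaks the count. -/
theorem sum_insertNeg {m : ℤ} (b : Bool) (w : List ℤ) (hw : ∀ y ∈ w, |y| < m) (h0 : w ≠ []) :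
    ∑ j ∈ Finset.range (w.length + 1),
      ((X : ℝ[X]) ^ altDesc b (insertNeg m w j) + X ^ altDesc b (insertNeg (-m) w j)) =
    (2 * (1 + X) + ((w.length : ℝ[X]) - 1) * (1 + X ^ 2)) * X ^ altDesc b w +
      (1 - X) * (1 + X ^ 2) * derivative (X ^ altDesc b w) := by
  obtain ⟨x, w, rfl⟩ := List.exists_cons_of_ne_nil h0
  have hx : |x| < m := hw x (by simp)
  obtain ⟨h1, h2⟩ := abs_lt.1 hx
  have h7 : -x < m := by omega
  have h8 : ¬ m < -x := by omega
  have h9 : ¬ m < x := by omega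
  rw [List.length_cons, Finset.sum_range_succ']
  simp only [insertNeg_cons_succ]
  rw [sum_insertNeg_cons b x w hx fun y hy => hw y (by simp [hy])]
  have key : (X : ℝ[X]) ^ altDesc b (insertNeg m (x :: w) 0) +
      X ^ altDesc b (insertNeg (-m) (x :: w) 0) = (1 + X) * X ^ altDesc b (x :: w) := by
    simp only [insertNeg_zero, altDesc_cons_cons, List.map_cons]
    rw [← List.map_cons, altDesc_map_neg, Bool.not_not]
    cases b <;> simp [h2, h7, h8, h9] <;> ring
  rw [key]
  push_cast
  ring

end Words

/-! ### Signed words and the recurrences of their generating polynomials -/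

section SignedWords

/-- The inserted letter is the only one of absolute value `N`, so it marks its own position. -/
theorem insertNeg_inj {N : ℕ} {a a' : ℤ} {w w' : List ℤ} {j j' : ℕ} (ha : a.natAbs = N)
    (ha' : a'.natAbs = N) (hw : ∀ y ∈ w, y.natAbs ≠ N) (hw' : ∀ y ∈ w', y.natAbs ≠ N)
    (hj : j ≤ w.length) (hj' : j' ≤ w'.length) (h : insertNeg a w j = insertNeg a' w' j') :
    a = a' ∧ w = w' ∧ j = j' := by
  induction j generalizing w w' j' with
  | zero =>
    cases j' with
    | zero =>
      rw [insertNeg_zero, insertNeg_zero, List.cons.injEq] at h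
      exact ⟨h.1, List.map_injective_iff.2 neg_injective h.2, rfl⟩
    | succ j' =>
      cases w' with
      | nil => simp at hj'
      | cons x w' =>
        rw [insertNeg_zero, insertNeg_cons_succ, List.cons.injEq] at h
        exact absurd (h.1 ▸ ha) (hw' x (by simp))
  | succ j ih =>
    cases w with
    | nil => simp at hj
    | cons x w =>
      cases j' with
      | zero =>
        rw [insertNeg_zero, insertNeg_cons_succ, List.cons.injEq] at h
        exact absurd (h.1 ▸ ha') (hw x (by simp))
      | succ j' =>
        cases w' with
        | nil => simp at hj'
        | cons x' w' =>
          rw [insertNeg_cons_succ, insertNeg_cons_succ, List.cons.injEq] at h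
          obtain ⟨h1, h2, h3⟩ := ih (fun y hy => hw y (by simp [hy]))
            (fun y hy => hw' y (by simp [hy])) (by simpa using hj) (by simpa using hj') h.2
          exact ⟨h1, by rw [h.1, h2], by rw [h3]⟩

/-- A word whose absolute values are `1, …, n` in some order. -/
def IsSignedWord (n : ℕ) (w : List ℤ) : Prop :=
  (w.map Int.natAbs).Perm (List.range' 1 n)

namespace IsSignedWord

variable {n : ℕ} {w : List ℤ}

theorem length_eq (h : IsSignedWord n w) : w.length = n := by
  simpa using List.Perm.length_eq h

theorem natAbs_mem (h : IsSignedWord n w) {y : ℤ} (hy : y ∈ w) :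
    1 ≤ y.natAbs ∧ y.natAbs ≤ n := by
  have := h.mem_iff.1 (List.mem_map_of_mem hy)
  rw [List.mem_range'_1] at this
  omega

theorem insertNeg (h : IsSignedWord n w) {a : ℤ} (ha : a.natAbs = n + 1) (j : ℕ) :
    IsSignedWord (n + 1) (insertNeg a w j) := by
  unfold IsSignedWord AltDescent.insertNeg
  have e : ((w.drop j).map Neg.neg).map Int.natAbs = (w.drop j).map Int.natAbs := by
    simp [List.map_map, Function.comp_def]
  rw [List.map_append, List.map_cons, e, ha, List.range'_1_concat]
  refine List.perm_middle.trans ?_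
  rw [← List.map_append, List.take_append_drop, add_comm 1 n]
  exact (h.cons _).trans (List.perm_append_singleton _ _).symm

theorem exists_insertNeg (h : IsSignedWord (n + 1) w) :
    ∃ a v j, a.natAbs = n + 1 ∧ IsSignedWord n v ∧ j ≤ n ∧ w = AltDescent.insertNeg a v j := by
  have hm : n + 1 ∈ w.map Int.natAbs := h.mem_iff.2 (by rw [List.mem_range'_1]; omega)
  obtain ⟨a, haw, ha⟩ := List.mem_map.1 hm
  obtain ⟨s, t, rfl⟩ := List.append_of_mem haw
  have hv : IsSignedWord n (s ++ t.map Neg.neg) := by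
    unfold IsSignedWord at h ⊢
    rw [List.map_append, List.map_cons, ha, List.range'_1_concat, add_comm 1 n] at h
    have := (List.perm_middle.symm.trans h).trans (List.perm_append_singleton _ _)
    simpa [List.map_map, Function.comp_def] using this.cons_inv
  refine ⟨a, _, s.length, ha, hv, ?_, ?_⟩
  · have := hv.length_eq
    simp at this
    omega
  · simp [AltDescent.insertNeg, List.map_map]

end IsSignedWord

/-- The finite set of words whose absolute values are `1, …, n` in some order. -/
def signedWords : ℕ → Finset (List ℤ)
  | 0 => {[]}
  | n + 1 => ((signedWords n ×ˢ Finset.range (n + 1)) ×ˢ {((n : ℤ) + 1), -((n : ℤ) + 1)}).image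
      fun p => insertNeg p.2 p.1.1 p.1.2

theorem natAbs_of_mem_pair {n : ℕ} {a : ℤ}
    (h : a ∈ ({((n : ℤ) + 1), -((n : ℤ) + 1)} : Finset ℤ)) : a.natAbs = n + 1 := by
  simp only [Finset.mem_insert, Finset.mem_singleton] at h
  omega

theorem mem_signedWords {n : ℕ} {w : List ℤ} : w ∈ signedWords n ↔ IsSignedWord n w := by
  induction n generalizing w with
  | zero => simp [signedWords, IsSignedWord]
  | succ n ih =>
    simp only [signedWords, Finset.mem_image, Finset.mem_product, Finset.mem_range, Prod.exists]
    constructor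
    · rintro ⟨v, j, a, ⟨⟨hv, -⟩, ha⟩, rfl⟩
      exact (ih.1 hv).insertNeg (natAbs_of_mem_pair ha) j
    · intro h
      obtain ⟨a, v, j, ha, hv, hj, rfl⟩ := h.exists_insertNeg
      refine ⟨v, j, a, ⟨⟨ih.2 hv, by omega⟩, ?_⟩, rfl⟩
      simp only [Finset.mem_insert, Finset.mem_singleton]
      omega

theorem sum_signedWords_succ {M : Type*} [AddCommMonoid M] (n : ℕ) (f : List ℤ → M) :
    ∑ w ∈ signedWords (n + 1), f w =
      ∑ w ∈ signedWords n, ∑ j ∈ Finset.range (n + 1),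
        (f (insertNeg (n + 1) w j) + f (insertNeg (-(n + 1)) w j)) := by
  rw [signedWords, Finset.sum_image, Finset.sum_product, Finset.sum_product]
  · refine Finset.sum_congr rfl fun w _ => Finset.sum_congr rfl fun j _ => ?_
    exact Finset.sum_pair (by omega)
  · rintro ⟨⟨v, j⟩, a⟩ h ⟨⟨v', j'⟩, a'⟩ h' e
    simp only [Finset.coe_product, Set.mem_prod, Finset.mem_coe, mem_signedWords,
      Finset.mem_range] at h h'
    have hv := h.1.1
    have hv' := h'.1.1
    obtain ⟨rfl, rfl, rfl⟩ := insertNeg_inj (natAbs_of_mem_pair h.2) (natAbs_of_mem_pair h'.2)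
      (fun y hy => by have := (hv.natAbs_mem hy).2; omega)
      (fun y hy => by have := (hv'.natAbs_mem hy).2; omega)
      (by rw [hv.length_eq]; exact Nat.lt_succ_iff.1 h.1.2)
      (by rw [hv'.length_eq]; exact Nat.lt_succ_iff.1 h'.1.2) e
    rfl

theorem card_signedWords (n : ℕ) : (signedWords n).card = 2 ^ n * n.factorial := by
  induction n with
  | zero => rfl
  | succ n ih =>
    rw [Finset.card_eq_sum_ones, sum_signedWords_succ]
    simp only [Finset.sum_const, Finset.card_range, ih, smul_eq_mul, Nat.factorial_succ]
    ring

theorem abs_lt_of_mem_signedWords {n : ℕ} {w : List ℤ} (h : w ∈ signedWords n) {y : ℤ}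
    (hy : y ∈ w) : |y| < (n : ℤ) + 1 := by
  have := ((mem_signedWords.1 h).natAbs_mem hy).2
  rw [Int.abs_eq_natAbs]
  omega

/-- The generating polynomial of the signed words of length `n`, preceded by the letter `0`, by
alternating descents (with ascents counted at the first position). -/
noncomputable def wordPolyB (n : ℕ) : ℝ[X] := ∑ w ∈ signedWords n, X ^ altDesc false (0 :: w)

/-- The generating polynomial of the signed words of length `n` by alternating descents. -/
noncomputable def wordPolyA (n : ℕ) : ℝ[X] := ∑ w ∈ signedWords n, X ^ altDesc true w

theorem wordPolyB_zero : wordPolyB 0 = 1 := by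
  simp [wordPolyB, signedWords, altDesc]

theorem wordPolyB_succ (n : ℕ) :
    wordPolyB (n + 1) = (1 + X + (n : ℝ[X]) * (1 + X ^ 2)) * wordPolyB n +
      (1 - X) * (1 + X ^ 2) * derivative (wordPolyB n) := by
  unfold wordPolyB
  rw [sum_signedWords_succ, derivative_sum, Finset.mul_sum, Finset.mul_sum,
    ← Finset.sum_add_distrib]
  refine Finset.sum_congr rfl fun w hw => ?_
  have hl := (mem_signedWords.1 hw).length_eq
  have := sum_insertNeg_cons (m := n + 1) false 0 w (by simp)
    (fun y hy => abs_lt_of_mem_signedWords hw hy)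
  rwa [hl] at this

theorem wordPolyA_one : wordPolyA 1 = 2 := by
  rw [wordPolyA, sum_signedWords_succ]
  simp [signedWords, insertNeg, altDesc]
  norm_num

theorem wordPolyA_succ {n : ℕ} (hn : n ≠ 0) :
    wordPolyA (n + 1) = (2 * (1 + X) + ((n : ℝ[X]) - 1) * (1 + X ^ 2)) * wordPolyA n +
      (1 - X) * (1 + X ^ 2) * derivative (wordPolyA n) := by
  unfold wordPolyA
  rw [sum_signedWords_succ, derivative_sum, Finset.mul_sum, Finset.mul_sum,
    ← Finset.sum_add_distrib]
  refine Finset.sum_congr rfl fun w hw => ?_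
  have hl := (mem_signedWords.1 hw).length_eq
  have := sum_insertNeg (m := n + 1) true w
    (fun y hy => abs_lt_of_mem_signedWords hw hy) (by rintro rfl; exact hn hl.symm)
  rwa [hl] at this

end SignedWords

/-! ### Type B permutations as signed words -/

section TypeB

variable {n : ℕ}

theorem mem_plusMinus {i : ℤ} : i ∈ plusMinus n ↔ 1 ≤ i.natAbs ∧ i.natAbs ≤ n := by
  simp only [plusMinus, Finset.mem_erase, Finset.mem_Icc]
  omega

theorem signedLetter_of_mem (σ : SignedPerm n) {i : ℕ} (h : (i : ℤ) ∈ plusMinus n) :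
    signedLetter σ i = σ.1 ⟨i, h⟩ := dif_pos h

/-- Here the default value matters: it supplies the convention `σ(0) = 0`. -/
theorem signedLetter_zero (σ : SignedPerm n) : signedLetter σ 0 = 0 :=
  dif_neg (by simp [plusMinus])

/-- The word `σ(1)⋯σ(n)` of a type B permutation. -/
noncomputable def signedWord (σ : SignedPerm n) : List ℤ :=
  (List.range n).map fun i => signedLetter σ (i + 1)

theorem altDesc_signedWord (σ : SignedPerm n) :
    altDesc false (0 :: signedWord σ) = (altDescentsB σ).card := by
  have e : 0 :: signedWord σ = (List.range (n + 1)).map (signedLetter σ) := by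
    rw [List.range_succ_eq_map, List.map_cons, List.map_map, signedLetter_zero]
    rfl
  rw [e, altDesc_map_range, altDescentsB, Finset.card_filter]
  refine Finset.sum_congr rfl fun i _ => ?_
  by_cases hi : Odd i
  · simp [hi, Nat.not_even_iff_odd.2 hi]
  · simp [hi, Nat.not_odd_iff_even.1 hi]

theorem natAbs_eq_of_natAbs_apply_eq (σ : SignedPerm n) {i j : plusMinus n}
    (h : (σ.1 i : ℤ).natAbs = (σ.1 j : ℤ).natAbs) : (i : ℤ).natAbs = (j : ℤ).natAbs := by
  rcases Int.natAbs_eq_natAbs_iff.1 h with h | h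
  · rw [σ.1.injective (Subtype.ext h)]
  · have hm : -(j : ℤ) ∈ plusMinus n := by
      have := mem_plusMinus.1 j.2
      rw [mem_plusMinus]
      omega
    rw [← σ.2 j ⟨-j, hm⟩ rfl] at h
    rw [σ.1.injective (Subtype.ext h)]
    simp

theorem isSignedWord_signedWord (σ : SignedPerm n) : IsSignedWord n (signedWord σ) := by
  have hm : ∀ i < n, ((i + 1 : ℕ) : ℤ) ∈ plusMinus n := fun i hi => by
    rw [mem_plusMinus]
    omega
  unfold IsSignedWord
  -- Pigeonhole: `n` distinct absolute values, all between `1` and `n`, exhaust that range.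
  refine List.Subperm.perm_of_length_le (List.subperm_of_subset ?_ ?_) (by simp [signedWord])
  · rw [signedWord, List.map_map]
    refine List.Nodup.map_on (fun i hi j hj h => ?_) List.nodup_range
    rw [List.mem_range] at hi hj
    simp only [Function.comp_apply, signedLetter_of_mem σ (hm i hi),
      signedLetter_of_mem σ (hm j hj)] at h
    have := natAbs_eq_of_natAbs_apply_eq σ h
    simp only at this
    omega
  · intro y hy
    simp only [signedWord, List.map_map, List.mem_map, List.mem_range, Function.comp_apply] at hy
    obtain ⟨i, hi, rfl⟩ := hy
    rw [signedLetter_of_mem σ (hm i hi), List.mem_range'_1]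
    have := mem_plusMinus.1 (σ.1 ⟨_, hm i hi⟩).2
    omega

theorem signedWord_injective : Function.Injective (signedWord (n := n)) := by
  intro σ τ h
  have hpos : ∀ (i : ℕ) (hi : (i : ℤ) ∈ plusMinus n), (σ.1 ⟨i, hi⟩ : ℤ) = τ.1 ⟨i, hi⟩ := by
    intro i hi
    have hi' := mem_plusMinus.1 hi
    rw [Int.natAbs_natCast] at hi'
    rw [← signedLetter_of_mem σ hi, ← signedLetter_of_mem τ hi]
    have := List.map_inj_left.1 h (i - 1) (List.mem_range.2 (by omega))
    rwa [Nat.sub_add_cancel hi'.1] at this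
  refine Subtype.ext (Equiv.ext fun i => Subtype.ext ?_)
  have hi : ((i : ℤ).natAbs : ℤ) ∈ plusMinus n := by
    have := mem_plusMinus.1 i.2
    rw [mem_plusMinus]
    omega
  rcases Int.natAbs_eq (i : ℤ) with h | h
  · have e : i = ⟨((i : ℤ).natAbs : ℤ), hi⟩ := Subtype.ext h
    rw [e]
    exact hpos _ hi
  · rw [σ.2 ⟨_, hi⟩ i h, τ.2 ⟨_, hi⟩ i h, hpos _ hi]

theorem exists_signedWord_eq {w : List ℤ} (hw : IsSignedWord n w) :
    ∃ σ : SignedPerm n, signedWord σ = w := by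
  have hl := hw.length_eq
  have hnd : (w.map Int.natAbs).Nodup := hw.nodup_iff.2 List.nodup_range'
  have hlt : ∀ i : plusMinus n, (i : ℤ).natAbs - 1 < w.length := fun i => by
    have := mem_plusMinus.1 i.2
    omega
  -- The odd extension of the word; list indices start at `0`, positions at `1`.
  let g : plusMinus n → ℤ := fun i => (i : ℤ).sign * w[(i : ℤ).natAbs - 1]'(hlt i)
  have hne : ∀ i : plusMinus n, (i : ℤ) ≠ 0 := fun i h => by
    have := mem_plusMinus.1 i.2
    omega
  have habs : ∀ i, (g i).natAbs = (w[(i : ℤ).natAbs - 1]'(hlt i)).natAbs := fun i => by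
    simp only [g]
    rw [Int.natAbs_mul, Int.natAbs_sign_of_ne_zero (hne i), one_mul]
  have hg : ∀ i, g i ∈ plusMinus n := fun i => by
    rw [mem_plusMinus, habs]
    exact hw.natAbs_mem (List.getElem_mem _)
  have hinj : Function.Injective fun i => (⟨g i, hg i⟩ : plusMinus n) := by
    intro i j h
    have h : g i = g j := congrArg Subtype.val h
    have h1 : (i : ℤ).natAbs - 1 = (j : ℤ).natAbs - 1 := by
      have h2 := congrArg Int.natAbs h
      rw [habs, habs] at h2
      refine (hnd.getElem_inj_iff (hi := by simpa using hlt i) (hj := by simpa using hlt j)).1 ?_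
      simpa using h2
    have h3 : (i : ℤ).natAbs = (j : ℤ).natAbs := by
      have := mem_plusMinus.1 i.2
      have := mem_plusMinus.1 j.2
      omega
    have h4 : (i : ℤ).sign = (j : ℤ).sign := by
      have h5 := (mem_plusMinus.1 (hg i)).1
      have h6 : w[(i : ℤ).natAbs - 1]'(hlt i) = w[(j : ℤ).natAbs - 1]'(hlt j) := by
        simp only [h3]
      rw [habs] at h5
      simp only [g, h6] at h
      rw [h6] at h5
      exact mul_right_cancel₀ (by omega) h
    refine Subtype.ext ?_
    rw [← Int.sign_mul_natAbs (i : ℤ), h4, h3, Int.sign_mul_natAbs]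
  refine ⟨⟨Equiv.ofBijective _ (Finite.injective_iff_bijective.1 hinj), fun i j h => ?_⟩, ?_⟩
  · simp [g, h]
  · refine List.ext_getElem (by simp [signedWord, hl]) fun k h1 h2 => ?_
    have hk : ((k + 1 : ℕ) : ℤ) ∈ plusMinus n := by
      rw [mem_plusMinus]
      omega
    simp only [signedWord, List.getElem_map, List.getElem_range]
    rw [signedLetter_of_mem _ hk]
    have hs : ((k : ℤ) + 1).sign = 1 := Int.sign_eq_one_of_pos (by omega)
    have ha : ((k : ℤ) + 1).natAbs - 1 = k := by omega
    simp [g, hs, ha]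

theorem altEulerianB_eq_wordPolyB (n : ℕ) : altEulerianB n = wordPolyB n := by
  refine Finset.sum_bij (fun σ _ => signedWord σ)
    (fun σ _ => mem_signedWords.2 (isSignedWord_signedWord σ))
    (fun σ _ τ _ h => signedWord_injective h) (fun w hw => ?_)
    (fun σ _ => by rw [altDesc_signedWord])
  obtain ⟨σ, rfl⟩ := exists_signedWord_eq (mem_signedWords.1 hw)
  exact ⟨σ, Finset.mem_univ _, rfl⟩

end TypeB

/-! ### Type A permutations with signed values -/

section TypeA

variable {n : ℕ}

theorem altDesc_ofFn (σ : Equiv.Perm (Fin n)) :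
    altDesc true (List.ofFn σ) = (altDescents σ).card := by
  cases n with
  | zero => simp [altDesc, altDescents]
  | succ n =>
    have hs : StrictMono fun i : Fin (n + 1) => (i : ℕ) + 1 := fun i j h => by
      simpa using h
    have e : (List.ofFn σ).map (fun i : Fin (n + 1) => (i : ℕ) + 1) =
        (List.range (n + 1)).map fun i => letter σ (i + 1) := by
      refine List.ext_getElem (by simp) fun i h1 h2 => ?_
      have hi : i + 1 ≤ n + 1 := by simpa using h2
      simp [letter, Nat.succ_le_succ_iff.1 hi, -List.ofFn_succ]
    rw [← altDesc_map_strictMono hs, e, altDesc_map_range, altDescents, Finset.card_filter,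
      Finset.sum_Ico_eq_sum_range]
    refine Finset.sum_congr rfl fun i _ => ?_
    -- Offset `i` in the list is position `i + 1`, so even offsets count descents, as the flag
    -- `true` prescribes.
    rw [add_comm 1 i]
    by_cases hi : Odd i
    · simp [hi, Nat.odd_add_one]
    · simp [hi, Nat.even_add_one, Nat.not_odd_iff_even.1 hi]

/-- The set of letters of the signed words of length `n` whose negative letters are the opposites
of the elements of `S`. -/
def signedLetters (n : ℕ) (S : Finset ℕ) : Finset ℤ :=
  (Finset.Icc 1 n).image fun v => if v ∈ S then -(v : ℤ) else v

theorem natAbs_ite_neg (S : Finset ℕ) (v : ℕ) : (if v ∈ S then -(v : ℤ) else v).natAbs = v := by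
  split_ifs <;> simp

theorem card_signedLetters (n : ℕ) (S : Finset ℕ) : (signedLetters n S).card = n := by
  rw [signedLetters, Finset.card_image_of_injective, Nat.card_Icc, Nat.add_sub_cancel]
  intro v v' h
  simpa only [natAbs_ite_neg] using congrArg Int.natAbs h

/-- The set `S` is recovered from the negative letters. -/
theorem signedLetters_injOn (n : ℕ) :
    Set.InjOn (signedLetters n) ((Finset.Icc 1 n).powerset : Set (Finset ℕ)) := by
  have key : ∀ S ∈ (Finset.Icc 1 n).powerset, ∀ v,
      v ∈ S ↔ 1 ≤ v ∧ -(v : ℤ) ∈ signedLetters n S := by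
    intro S hS v
    rw [Finset.mem_powerset] at hS
    simp only [signedLetters, Finset.mem_image]
    constructor
    · intro hv
      exact ⟨(Finset.mem_Icc.1 (hS hv)).1, v, hS hv, by simp [hv]⟩
    · rintro ⟨h1, u, -, h⟩
      split_ifs at h with hu
      · rwa [← Int.ofNat.inj (neg_injective h)]
      · omega
  intro S hS T hT h
  ext v
  rw [key S hS, key T hT, h]

theorem natAbs_mem_of_mem_signedLetters {S : Finset ℕ} {y : ℤ} (h : y ∈ signedLetters n S) :
    1 ≤ y.natAbs ∧ y.natAbs ≤ n := by
  obtain ⟨v, hv, rfl⟩ := Finset.mem_image.1 h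
  rw [natAbs_ite_neg]
  exact Finset.mem_Icc.1 hv

theorem natAbs_injOn_signedLetters (n : ℕ) (S : Finset ℕ) :
    Set.InjOn Int.natAbs (signedLetters n S : Set ℤ) := by
  intro y hy z hz h
  obtain ⟨v, hv, rfl⟩ := Finset.mem_image.1 hy
  obtain ⟨u, hu, rfl⟩ := Finset.mem_image.1 hz
  simp only [natAbs_ite_neg] at h
  rw [h]

/-- The word with letters in `signedLetters n S` in the same relative order as `σ`. -/
def relabel (S : Finset ℕ) (σ : Equiv.Perm (Fin n)) : List ℤ :=
  (List.ofFn σ).map ((signedLetters n S).orderEmbOfFin (card_signedLetters n S))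

theorem altDesc_relabel (S : Finset ℕ) (σ : Equiv.Perm (Fin n)) :
    altDesc true (relabel S σ) = (altDescents σ).card := by
  rw [relabel, altDesc_map_strictMono (OrderEmbedding.strictMono _), altDesc_ofFn]

theorem mem_relabel {S : Finset ℕ} {σ : Equiv.Perm (Fin n)} {y : ℤ} :
    y ∈ relabel S σ ↔ y ∈ signedLetters n S := by
  rw [← Finset.mem_coe, ← Finset.range_orderEmbOfFin _ (card_signedLetters n S), relabel,
    List.mem_map]
  constructor
  · rintro ⟨i, -, rfl⟩
    exact ⟨i, rfl⟩
  · rintro ⟨i, rfl⟩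
    exact ⟨i, List.mem_ofFn.2 (σ.surjective i), rfl⟩

theorem isSignedWord_relabel (S : Finset ℕ) (σ : Equiv.Perm (Fin n)) :
    IsSignedWord n (relabel S σ) := by
  unfold IsSignedWord
  refine List.Subperm.perm_of_length_le (List.subperm_of_subset ?_ ?_) (by simp [relabel])
  · refine List.Nodup.map_on (fun y hy z hz h => natAbs_injOn_signedLetters n S
      (mem_relabel.1 hy) (mem_relabel.1 hz) h) ?_
    exact (List.nodup_ofFn.2 σ.injective).map (RelEmbedding.injective _)
  · intro y hy
    obtain ⟨z, hz, rfl⟩ := List.mem_map.1 hy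
    have := natAbs_mem_of_mem_signedLetters (mem_relabel.1 hz)
    rw [List.mem_range'_1]
    omega

theorem relabel_injOn (n : ℕ) :
    Set.InjOn (fun p : Finset ℕ × Equiv.Perm (Fin n) => relabel p.1 p.2)
      ((Finset.Icc 1 n).powerset ×ˢ Finset.univ : Finset (Finset ℕ × Equiv.Perm (Fin n))) := by
  rintro ⟨S, σ⟩ hS ⟨T, τ⟩ hT h
  simp only [Finset.coe_product, Set.mem_prod] at hS hT h
  obtain rfl : S = T := signedLetters_injOn n hS.1 hT.1 <| by
    ext y
    rw [← mem_relabel (σ := σ), h, mem_relabel]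
  have := List.ofFn_injective (List.map_injective_iff.2 (RelEmbedding.injective _) h)
  rw [DFunLike.coe_injective this]

theorem wordPolyA_eq (n : ℕ) : wordPolyA n = 2 ^ n * altEulerianA n := by
  have himg : ((Finset.Icc 1 n).powerset ×ˢ (Finset.univ : Finset (Equiv.Perm (Fin n)))).image
      (fun p => relabel p.1 p.2) = signedWords n := by
    -- Relabelling is injective and both sides have `2 ^ n * n!` elements, so no inverse is needed.
    refine Finset.eq_of_subset_of_card_le (fun w hw => ?_) ?_
    · obtain ⟨p, -, rfl⟩ := Finset.mem_image.1 hw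
      exact mem_signedWords.2 (isSignedWord_relabel _ _)
    · rw [card_signedWords, Finset.card_image_of_injOn (relabel_injOn n), Finset.card_product,
        Finset.card_powerset, Nat.card_Icc, Finset.card_univ, Fintype.card_perm,
        Fintype.card_fin, Nat.add_sub_cancel]
  rw [wordPolyA, ← himg, Finset.sum_image (relabel_injOn n), Finset.sum_product]
  simp only [altDesc_relabel]
  rw [Finset.sum_const, Finset.card_powerset, Nat.card_Icc, Nat.add_sub_cancel, altEulerianA,
    nsmul_eq_mul]
  push_cast
  rfl

end TypeA

/-! ### Derivative polynomials under the Möbius substitution -/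

section DerivPoly

theorem tanDerivPoly_spec (n : ℕ) : IsTanDerivPoly n (tanDerivPoly n) :=
  (existsUnique_tanDerivPoly n).choose_spec.1

theorem secDerivPoly_spec (n : ℕ) : IsSecDerivPoly n (secDerivPoly n) :=
  (existsUnique_secDerivPoly n).choose_spec.1

theorem tanDerivPoly_zero : tanDerivPoly 0 = X :=
  (existsUnique_tanDerivPoly 0).unique (tanDerivPoly_spec 0) fun x _ => by simp

theorem tanDerivPoly_succ (n : ℕ) :
    tanDerivPoly (n + 1) = (1 + X ^ 2) * derivative (tanDerivPoly n) :=
  (existsUnique_tanDerivPoly (n + 1)).unique (tanDerivPoly_spec _) (tanDerivPoly_spec n).succ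

theorem secDerivPoly_zero : secDerivPoly 0 = 1 :=
  (existsUnique_secDerivPoly 0).unique (secDerivPoly_spec 0) fun x _ => by simp

theorem secDerivPoly_succ (n : ℕ) :
    secDerivPoly (n + 1) = X * secDerivPoly n + (1 + X ^ 2) * derivative (secDerivPoly n) :=
  (existsUnique_secDerivPoly (n + 1)).unique (secDerivPoly_spec _) (secDerivPoly_spec n).succ

theorem hasDerivAt_moebius {x : ℝ} (hx : 1 - x ≠ 0) :
    HasDerivAt (fun y : ℝ => (1 + y) / (1 - y)) (2 / (1 - x) ^ 2) x := by
  have h := ((hasDerivAt_id' x).const_add 1).fun_div ((hasDerivAt_id' x).const_sub 1) hx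
  have e : (1 * (1 - x) - (1 + x) * -1) / (1 - x) ^ 2 = 2 / (1 - x) ^ 2 := by
    ring
  rwa [e] at h

/-- Differentiating `H(x) = (1 - x)ⁿ Q((1 + x) / (1 - x))`. -/
theorem eval_derivative_moebius {n : ℕ} {H Q : ℝ[X]}
    (h : ∀ x : ℝ, 1 - x ≠ 0 → H.eval x = (1 - x) ^ n * Q.eval ((1 + x) / (1 - x)))
    {x : ℝ} (hx : 1 - x ≠ 0) :
    2 * (1 - x) ^ n * (derivative Q).eval ((1 + x) / (1 - x)) =
      (1 - x) * ((1 - x) * (derivative H).eval x + n * H.eval x) := by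
  have h1 : HasDerivAt (fun y => (1 - y) ^ n * Q.eval ((1 + y) / (1 - y))) _ x :=
    (((hasDerivAt_id' x).const_sub 1).fun_pow n).mul
      ((Q.hasDerivAt _).comp x (hasDerivAt_moebius hx))
  have h2 : (fun y => H.eval y) =ᶠ[nhds x]
      fun y => (1 - y) ^ n * Q.eval ((1 + y) / (1 - y)) := by
    have : ∀ᶠ y : ℝ in nhds x, 1 - y ≠ 0 :=
      (continuous_const.sub continuous_id).continuousAt.eventually_ne hx
    filter_upwards [this] with y hy using h y hy
  have h3 := (H.hasDerivAt x).unique (h1.congr_of_eventuallyEq h2)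
  rw [h3, h x hx]
  -- The power rule yields the truncated exponent `n - 1`, so `n = 0` is treated apart.
  cases n with
  | zero => simp; field_simp
  | succ n =>
    simp only [Nat.add_sub_cancel]
    push_cast
    field_simp
    ring

theorem eval_wordPolyB (n : ℕ) {x : ℝ} (hx : 1 - x ≠ 0) :
    (wordPolyB n).eval x = (1 - x) ^ n * (secDerivPoly n).eval ((1 + x) / (1 - x)) := by
  induction n generalizing x with
  | zero => simp [wordPolyB_zero, secDerivPoly_zero]
  | succ n ih =>
    have h := eval_derivative_moebius (fun x hx => ih hx) hx
    have h0 := ih hx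
    rw [wordPolyB_succ, secDerivPoly_succ]
    simp only [eval_add, eval_mul, eval_sub, eval_one, eval_X, eval_pow, eval_natCast]
    have e : (1 - x) ^ (n + 1) * ((1 + x) / (1 - x) * (secDerivPoly n).eval ((1 + x) / (1 - x)) +
        (1 + ((1 + x) / (1 - x)) ^ 2) * (derivative (secDerivPoly n)).eval ((1 + x) / (1 - x))) =
        (1 + x) * ((1 - x) ^ n * (secDerivPoly n).eval ((1 + x) / (1 - x))) +
        (1 + x ^ 2) / (1 - x) *
          (2 * (1 - x) ^ n * (derivative (secDerivPoly n)).eval ((1 + x) / (1 - x))) := by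
      generalize (secDerivPoly n).eval _ = q
      generalize (derivative (secDerivPoly n)).eval _ = q'
      field_simp
      ring
    rw [e, h, ← h0]
    field_simp
    ring

/-- The factor `1 + X ^ 2` absorbs the difference between the two recurrences: its derivative
contributes `2 * x * (1 - x)`, and `2 * x * (1 - x) + 2 * (1 + x ^ 2) = 2 * (1 + x)`. -/
theorem eval_wordPolyA (n : ℕ) {x : ℝ} (hx : 1 - x ≠ 0) :
    ((1 + X ^ 2) * wordPolyA (n + 1)).eval x =
      (1 - x) ^ (n + 2) * (tanDerivPoly (n + 1)).eval ((1 + x) / (1 - x)) := by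
  induction n generalizing x with
  | zero =>
    simp [wordPolyA_one, tanDerivPoly_zero, tanDerivPoly_succ]
    field_simp
    ring
  | succ n ih =>
    have h := eval_derivative_moebius (fun x hx => ih hx) hx
    rw [wordPolyA_succ n.succ_ne_zero, tanDerivPoly_succ (n + 1)]
    simp only [eval_add, eval_mul, eval_sub, eval_one, eval_X, eval_pow, eval_natCast,
      eval_ofNat, derivative_mul, derivative_add, derivative_one, derivative_X_pow,
      eval_C, Nat.cast_ofNat, eval_zero] at h ⊢
    have e : (1 - x) ^ (n + 1 + 2) * ((1 + ((1 + x) / (1 - x)) ^ 2) *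
        (derivative (tanDerivPoly (n + 1))).eval ((1 + x) / (1 - x))) =
        (1 + x ^ 2) / (1 - x) *
          (2 * (1 - x) ^ (n + 2) *
            (derivative (tanDerivPoly (n + 1))).eval ((1 + x) / (1 - x))) := by
      generalize (derivative (tanDerivPoly (n + 1))).eval _ = q'
      field_simp
      ring
    rw [e, h]
    field_simp
    push_cast
    ring

theorem one_sub_ratFuncX_ne_zero : (1 - RatFunc.X : RatFunc ℝ) ≠ 0 := by
  rw [sub_ne_zero, ← RatFunc.algebraMap_X, ← map_one (algebraMap ℝ[X] (RatFunc ℝ))]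
  exact fun h => by simpa using congrArg (eval 0) (RatFunc.algebraMap_injective ℝ h)

/-- Clearing denominators in `Q((1 + x) / (1 - x))`. -/
theorem exists_homogenization (Q : ℝ[X]) : ∃ (N : ℕ) (H : ℝ[X]),
    (aeval (RatFunc.X : RatFunc ℝ) H =
      (1 - RatFunc.X) ^ N * aeval ((1 + RatFunc.X) / (1 - RatFunc.X) : RatFunc ℝ) Q) ∧
    ∀ x : ℝ, 1 - x ≠ 0 → H.eval x = (1 - x) ^ N * Q.eval ((1 + x) / (1 - x)) := by
  have hX := one_sub_ratFuncX_ne_zero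
  induction Q using Polynomial.induction_on' with
  | add p q hp hq =>
    obtain ⟨N, H, h1, h2⟩ := hp
    obtain ⟨M, K, h3, h4⟩ := hq
    refine ⟨N + M, (1 - X) ^ M * H + (1 - X) ^ N * K, ?_, fun x hx => ?_⟩
    · simp only [map_add, map_mul, map_pow, map_sub, map_one, aeval_X, h1, h3]
      ring
    · simp only [eval_add, eval_mul, eval_pow, eval_sub, eval_one, eval_X, h2 x hx, h4 x hx]
      ring
  | monomial k a =>
    refine ⟨k, C a * (1 + X) ^ k, ?_, fun x hx => ?_⟩
    · simp only [map_mul, map_pow, map_add, map_one, aeval_X, aeval_C, aeval_monomial, div_pow]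
      field_simp
    · simp only [eval_add, eval_mul, eval_pow, eval_one, eval_X, eval_C, eval_monomial, div_pow]
      field_simp

/-- Once denominators are cleared, both sides are polynomials that agree at every real `x ≠ 1`,
hence equal; the power of `1 - X` is then cancelled in the field. -/
theorem aeval_eq_of_eval_eq {n : ℕ} {H Q : ℝ[X]}
    (h : ∀ x : ℝ, 1 - x ≠ 0 → H.eval x = (1 - x) ^ n * Q.eval ((1 + x) / (1 - x))) :
    aeval (RatFunc.X : RatFunc ℝ) H =
      (1 - RatFunc.X) ^ n * aeval ((1 + RatFunc.X) / (1 - RatFunc.X) : RatFunc ℝ) Q := by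
  have hX := one_sub_ratFuncX_ne_zero
  obtain ⟨N, K, h1, h2⟩ := exists_homogenization Q
  have e : (1 - X) ^ N * H = (1 - X) ^ n * K := by
    refine Polynomial.eq_of_infinite_eval_eq _ _
      ((Set.finite_singleton (1 : ℝ)).infinite_compl.mono fun x hx => ?_)
    have hx' : 1 - x ≠ 0 := sub_ne_zero.2 fun h => hx h.symm
    simp only [Set.mem_ofPred_eq, eval_mul, eval_pow, eval_sub, eval_one, eval_X, h x hx',
      h2 x hx']
    ring
  have e' := congrArg (aeval (RatFunc.X : RatFunc ℝ)) e
  simp only [map_mul, map_pow, map_sub, map_one, aeval_X, h1] at e'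
  refine mul_left_cancel₀ (pow_ne_zero N hX) (e'.trans ?_)
  ring

end DerivPoly

end AltDescent

theorem theorem2 (n : ℕ) :
    (1 ≤ n →
      (2 : RatFunc ℝ) ^ n * (1 + RatFunc.X ^ 2) *
          Polynomial.aeval (RatFunc.X : RatFunc ℝ) (AltDescent.altEulerianA n) =
        (1 - RatFunc.X) ^ (n + 1) *
          Polynomial.aeval ((1 + RatFunc.X) / (1 - RatFunc.X) : RatFunc ℝ)
            (AltDescent.tanDerivPoly n)) ∧
    Polynomial.aeval (RatFunc.X : RatFunc ℝ) (AltDescent.altEulerianB n) =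
      (1 - RatFunc.X) ^ n *
        Polynomial.aeval ((1 + RatFunc.X) / (1 - RatFunc.X) : RatFunc ℝ)
          (AltDescent.secDerivPoly n) := by
  constructor
  · intro hn
    obtain ⟨k, rfl⟩ := Nat.exists_eq_add_of_le' hn
    rw [← AltDescent.aeval_eq_of_eval_eq fun x hx => AltDescent.eval_wordPolyA k hx,
      AltDescent.wordPolyA_eq]
    simp only [map_mul, map_add, map_pow, map_one, aeval_X, map_ofNat]
    ring
  · rw [AltDescent.altEulerianB_eq_wordPolyB]
    exact AltDescent.aeval_eq_of_eval_eq fun x hx => AltDescent.eval_wordPolyB n hx
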